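/- Let $q,a,b$ be complex numbers with $0<|q|<1$. Write $(x;q)_\infty=\prod_{i\ge 0}(1-xq^i)$, $(x;q)_n=\prod_{i=0}^{n-1}(1-xq^i)$, $(x_1,\dots,x_r;q)_n=(x_1;q)_n\cdots(x_r;q)_n$ for $n\in\mathbb{N}\cup\{\infty\}$, and $$\theta(q,x)=\sum_{n=0}^{\infty}(-1)^nq^{\binom n2}x^n .$$ Assume that no denominator below vanishes, i.e. $a\neq 0$, $b\neq 0$, $a\neq bq$, $b\neq aq$, and $aq^n\neq 1$, $bq^n\neq 1$, $\frac{ab}{q^3}q^n\neq 1$ for all integers $n\ge 0$. Then the series in $$S(a,b)=(q,a,b;q)_\infty\sum_{n=0}^{\infty}\frac{(ab/q^3;q)_{2n}}{(q,a,b,ab/q^3;q)_n}\,q^{2n}$$ converges absolutely, and $$\frac{a^2+2aq+aq^2-bq^2+ab}{b(a-bq)(b-aq)}\,\theta(q,a)-\frac{(a+q)(a+b)}{a(a-bq)(b-aq)}\,\theta(q,b)+\frac{(1+q)(b+q^2)}{b(a-bq)(b-aq)}\,\theta(q,a/q)-\frac{a(1+q)(b+q^2)+q(a^2-b^2)}{ab(a-bq)(b-aq)}\,\theta(q,b/q)=-\frac{a-b}{qab}\,S(a,b).$$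 -/

import Mathlib

/-- The infinite `q`-shifted factorial `(x;q)_∞ = ∏_{i ≥ 0} (1 - x q^i)`. -/
noncomputable def qPochInf (x q : ℂ) : ℂ := ∏' i : ℕ, (1 - x * q ^ i)

/-- The finite `q`-shifted factorial `(x;q)_n = ∏_{i=0}^{n-1} (1 - x q^i)`, that is
`(x;q)_∞ / (x q^n;q)_∞` (see `qPoch_mul_qPochInf`). -/
noncomputable def qPoch (x q : ℂ) (n : ℕ) : ℂ := ∏ i ∈ Finset.range n, (1 - x * q ^ i)

/-- The partial theta function `θ(q,x) = ∑_{n ≥ 0} (-1)^n q^{n(n-1)/2} x^n`. -/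
noncomputable def partialTheta (q x : ℂ) : ℂ := ∑' n : ℕ, (-1) ^ n * q ^ n.choose 2 * x ^ n

/-- The `n`-th term `(ab/q³;q)_{2n} q^{2n} / ((q;q)_n (a;q)_n (b;q)_n (ab/q³;q)_n)`. -/
noncomputable def seriesSTerm (q a b : ℂ) (n : ℕ) : ℂ :=
  qPoch (a * b / q ^ 3) q (2 * n) /
    (qPoch q q n * qPoch a q n * qPoch b q n * qPoch (a * b / q ^ 3) q n) * q ^ (2 * n)

/-- `S(a,b) = (q,a,b;q)_∞ ∑_{n ≥ 0} (ab/q³;q)_{2n} q^{2n} / (q,a,b,ab/q³;q)_n`. -/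
noncomputable def seriesS (q a b : ℂ) : ℂ :=
  qPochInf q q * qPochInf a q * qPochInf b q * ∑' n : ℕ, seriesSTerm q a b n

/-- The infinite product defining `(x;q)_∞` converges for `|q| < 1`. -/
theorem multipliable_qPochInf (x : ℂ) {q : ℂ} (hq : ‖q‖ < 1) :
    Multipliable fun i : ℕ => 1 - x * q ^ i := by
  have h : Summable fun i : ℕ => ‖-(x * q ^ i)‖ := by
    simp only [norm_neg, norm_mul, norm_pow]
    exact (summable_geometric_of_lt_one (norm_nonneg q) hq).mul_left _
  simpa [sub_eq_add_neg] using multipliable_one_add_of_summable h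

/-- `(x;q)_n (x q^n;q)_∞ = (x;q)_∞` for `|q| < 1`. -/
theorem qPoch_mul_qPochInf (x : ℂ) {q : ℂ} (hq : ‖q‖ < 1) (n : ℕ) :
    qPoch x q n * qPochInf (x * q ^ n) q = qPochInf x q := by
  have h := multipliable_qPochInf (x * q ^ n) hq
  have e : (fun i : ℕ => 1 - x * q ^ n * q ^ i) = fun i : ℕ => 1 - x * q ^ (i + n) := by
    funext i
    ring
  unfold qPoch qPochInf
  rw [e] at h ⊢
  exact h.prod_mul_tprod_nat_mul' (f := fun i : ℕ => 1 - x * q ^ i)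

/-- The series defining `θ(q,x)` converges for `|q| < 1`. -/
theorem summable_partialTheta {q : ℂ} (hq : ‖q‖ < 1) (x : ℂ) :
    Summable fun n : ℕ => (-1) ^ n * q ^ n.choose 2 * x ^ n := by
  have ht : Filter.Tendsto (fun n : ℕ => ‖q ^ n * x‖) Filter.atTop (nhds 0) := by
    have := (tendsto_pow_atTop_nhds_zero_of_norm_lt_one hq).mul_const x
    simpa using this.norm
  refine summable_of_ratio_norm_eventually_le (r := 1 / 2) (by norm_num) ?_
  filter_upwards [ht.eventually (ge_mem_nhds (show (0 : ℝ) < 1 / 2 by norm_num))] with n hn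
  have e : (-1 : ℂ) ^ (n + 1) * q ^ (n + 1).choose 2 * x ^ (n + 1) =
      -((q ^ n * x) * ((-1) ^ n * q ^ n.choose 2 * x ^ n)) := by
    rw [Nat.choose_succ_succ' n 1, Nat.choose_one_right]
    ring
  rw [e, norm_neg, norm_mul]
  exact mul_le_mul_of_nonneg_right hn (norm_nonneg _)

open Filter Topology

/-! ### Recurrences, bounds and limits of q-shifted factorials. -/

section QPochhammer

variable {q : ℂ}

/-! Absorbing the infinite products into the terms turns `seriesS` into `qSum` with k = 2, c =
ab/q³. Lowering a or b to a/q or b/q relates k + 1 to k, so (a-b)/q times this sum is a difference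
of two k = 1 sums (`sub_mul_qSum_succ`), both of the shape c = xy/q². `sub_mul_qSum` evaluates these
as x θ(q,x) - y θ(q,y), up to the factor x - y; the recurrence θ(x) + x θ(xq) = 1 does the rest.
That evaluation rests on the product formula `qSum_eq_partialTheta_mul` at c = xy/q, which holds
because its left side satisfies in x a q-difference equation whose suitably convergent solutions are
multiples of θ. -/

lemma qPoch_succ (x q : ℂ) (n : ℕ) : qPoch x q (n + 1) = qPoch x q n * (1 - x * q ^ n) :=
  Finset.prod_range_succ _ _

lemma qPoch_succ' (x q : ℂ) (n : ℕ) : qPoch x q (n + 1) = (1 - x) * qPoch (x * q) q n := by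
  unfold qPoch
  rw [Finset.prod_range_succ', mul_comm]
  simp [pow_succ', mul_assoc]

lemma qPoch_add (x q : ℂ) (m n : ℕ) :
    qPoch x q (m + n) = qPoch x q m * qPoch (x * q ^ m) q n := by
  unfold qPoch
  rw [Finset.prod_range_add]
  simp [pow_add, mul_assoc]

lemma qPochInf_eq_mul (x : ℂ) (hq : ‖q‖ < 1) :
    qPochInf x q = (1 - x) * qPochInf (x * q) q := by
  have h := qPoch_mul_qPochInf x hq 1
  simpa [qPoch] using h.symm

lemma qPochInf_ne_zero (hq : ‖q‖ < 1) {x : ℂ} (hx : ∀ n : ℕ, x * q ^ n ≠ 1) :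
    qPochInf x q ≠ 0 := by
  have h : Summable fun i : ℕ => ‖-(x * q ^ i)‖ := by
    simp only [norm_neg, norm_mul, norm_pow]
    exact (summable_geometric_of_lt_one (norm_nonneg q) hq).mul_left _
  have := tprod_one_add_ne_zero_of_summable (f := fun i : ℕ => -(x * q ^ i))
    (fun i => by rw [← sub_eq_add_neg]; exact sub_ne_zero.2 (hx i).symm) h
  simpa [qPochInf, sub_eq_add_neg] using this

lemma norm_qPoch_sub_one_le (x : ℂ) (hq : ‖q‖ < 1) (n : ℕ) :
    ‖qPoch x q n - 1‖ ≤ Real.exp (‖x‖ / (1 - ‖q‖)) - 1 := by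
  have h := (Finset.range n).norm_prod_one_add_sub_one_le fun i => -(x * q ^ i)
  simp only [← sub_eq_add_neg] at h
  refine h.trans (sub_le_sub_right (Real.exp_le_exp.2 ?_) _)
  simp only [norm_neg, norm_mul, norm_pow, ← Finset.mul_sum, div_eq_mul_inv]
  rw [← tsum_geometric_of_lt_one (norm_nonneg q) hq]
  exact mul_le_mul_of_nonneg_left ((summable_geometric_of_lt_one (norm_nonneg q) hq).sum_le_tsum _
    fun i _ => by positivity) (norm_nonneg x)

lemma norm_qPochInf_sub_one_le (x : ℂ) (hq : ‖q‖ < 1) :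
    ‖qPochInf x q - 1‖ ≤ Real.exp (‖x‖ / (1 - ‖q‖)) - 1 :=
  le_of_tendsto ((multipliable_qPochInf x hq).hasProd.tendsto_prod_nat.sub_const 1).norm
    (Eventually.of_forall fun n => norm_qPoch_sub_one_le x hq n)

lemma norm_le_of_norm_sub_one_le {z : ℂ} {r : ℝ} (h : ‖z - 1‖ ≤ r - 1) : ‖z‖ ≤ r := by
  have := norm_sub_norm_le z 1
  rw [norm_one] at this
  linarith

lemma norm_qPoch_le {x : ℂ} {r : ℝ} (hq : ‖q‖ < 1) (hx : ‖x‖ ≤ r) (n : ℕ) :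
    ‖qPoch x q n‖ ≤ Real.exp (r / (1 - ‖q‖)) :=
  (norm_le_of_norm_sub_one_le (norm_qPoch_sub_one_le x hq n)).trans
    (Real.exp_le_exp.2 (div_le_div_of_nonneg_right hx (by linarith)))

lemma norm_qPochInf_le {x : ℂ} {r : ℝ} (hq : ‖q‖ < 1) (hx : ‖x‖ ≤ r) :
    ‖qPochInf x q‖ ≤ Real.exp (r / (1 - ‖q‖)) :=
  (norm_le_of_norm_sub_one_le (norm_qPochInf_sub_one_le x hq)).trans
    (Real.exp_le_exp.2 (div_le_div_of_nonneg_right hx (by linarith)))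

lemma tendsto_one_of_norm_sub_one_le {u z : ℕ → ℂ} (hu : Tendsto u atTop (𝓝 0))
    (h : ∀ n, ‖z n - 1‖ ≤ Real.exp (‖u n‖ / (1 - ‖q‖)) - 1) : Tendsto z atTop (𝓝 1) := by
  rw [tendsto_iff_norm_sub_tendsto_zero]
  refine squeeze_zero (fun _ => norm_nonneg _) h ?_
  have h1 : Tendsto (fun n => ‖u n‖ / (1 - ‖q‖)) atTop (𝓝 0) := by
    simpa using hu.norm.div_const (1 - ‖q‖)
  simpa using ((Real.continuous_exp.tendsto 0).comp h1).sub_const 1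

lemma norm_mul_pow_le (x : ℂ) (hq : ‖q‖ < 1) (n : ℕ) : ‖x * q ^ n‖ ≤ ‖x‖ := by
  rw [norm_mul, norm_pow]
  exact mul_le_of_le_one_right (norm_nonneg _) (pow_le_one₀ (norm_nonneg _) hq.le)

lemma tendsto_mul_pow_zero (x : ℂ) (hq : ‖q‖ < 1) :
    Tendsto (fun N : ℕ => x * q ^ N) atTop (𝓝 0) := by
  simpa using (tendsto_pow_atTop_nhds_zero_of_norm_lt_one hq).const_mul x

lemma mul_pow_ne_one (hq : ‖q‖ < 1) (n : ℕ) : q * q ^ n ≠ 1 := fun h => by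
  have := norm_mul_pow_le q hq n
  rw [h, norm_one] at this
  linarith

end QPochhammer

/-! ### Characterization of θ by q-difference equations. -/

section PartialTheta

variable {q : ℂ}

lemma partialTheta_add_mul (hq : ‖q‖ < 1) (x : ℂ) :
    partialTheta q x + x * partialTheta q (x * q) = 1 := by
  unfold partialTheta
  rw [(summable_partialTheta hq x).tsum_eq_zero_add, ← tsum_mul_left]
  have h : ∀ n : ℕ, (-1 : ℂ) ^ (n + 1) * q ^ (n + 1).choose 2 * x ^ (n + 1) =
      -(x * ((-1) ^ n * q ^ n.choose 2 * (x * q) ^ n)) := fun n => by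
    rw [Nat.choose_succ_succ' n 1, Nat.choose_one_right]
    ring
  simp only [h, tsum_neg]
  simp

/-- A solution of `h(x) = -x h(xq)` which is bounded along `x, xq, xq², …` vanishes at `x`. -/
lemma eq_zero_of_eq_neg_mul (hq : ‖q‖ < 1) {h : ℂ → ℂ} {l : ℂ}
    (hh : ∀ x, h x = -x * h (x * q)) (x : ℂ)
    (hl : Tendsto (fun N : ℕ => h (x * q ^ N)) atTop (𝓝 l)) : h x = 0 := by
  have key : ∀ N : ℕ, h x = (-1) ^ N * q ^ N.choose 2 * x ^ N * h (x * q ^ N) := fun N => by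
    induction N with
    | zero => simp
    | succ N ih =>
      rw [ih, hh (x * q ^ N), Nat.choose_succ_succ' N 1, Nat.choose_one_right]
      ring_nf
  -- The prefactor is the general term of the θ series, so it tends to 0.
  have h0 := (summable_partialTheta hq x).tendsto_atTop_zero.mul hl
  rw [zero_mul] at h0
  exact tendsto_nhds_unique (tendsto_const_nhds.congr key) h0

lemma tendsto_partialTheta_mul_pow (hq : ‖q‖ < 1) (x : ℂ) :
    Tendsto (fun N : ℕ => partialTheta q (x * q ^ N)) atTop (𝓝 (partialTheta q 0)) := by
  unfold partialTheta
  refine tendsto_tsum_of_dominated_convergence (summable_partialTheta hq x).norm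
    (fun n => ?_) (Eventually.of_forall fun N n => ?_)
  · exact ((tendsto_mul_pow_zero x hq).pow n).const_mul _
  · rw [norm_mul _ (_ ^ n), norm_mul _ (x ^ n), norm_pow _ n, norm_pow x n]
    exact mul_le_mul_of_nonneg_left (pow_le_pow_left₀ (norm_nonneg _) (norm_mul_pow_le x hq N) n)
      (norm_nonneg _)

/-- The second-order `q`-difference equation that characterizes the multiples of `θ(q,·)`. -/
lemma eq_mul_partialTheta (hq : ‖q‖ < 1) {f : ℂ → ℂ}
    (hf : ∀ x, f x + x * f (x * q) = f (x * q) + x * q * f (x * q ^ 2))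
    (hl : ∀ x, Tendsto (fun N : ℕ => f (x * q ^ N)) atTop (𝓝 (f 0))) (x : ℂ) :
    f x = f 0 * partialTheta q x := by
  -- The hypothesis says that f(x) + x f(xq) is unchanged under x → xq, so it equals its limit f(0).
  have h1 : ∀ x, f x + x * f (x * q) = f 0 := fun x => by
    have key : ∀ N : ℕ,
        f x + x * f (x * q) = f (x * q ^ N) + x * q ^ N * f (x * q ^ (N + 1)) := fun N => by
      induction N with
      | zero => simp
      | succ N ih =>
        rw [ih, pow_succ, ← mul_assoc, hf]
        ring_nf
    have h0 := (hl x).add ((tendsto_mul_pow_zero x hq).mul ((tendsto_add_atTop_iff_nat 1).2 (hl x)))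
    rw [zero_mul, add_zero] at h0
    exact tendsto_nhds_unique (tendsto_const_nhds.congr key) h0
  refine sub_eq_zero.1 (eq_zero_of_eq_neg_mul hq (h := fun x => f x - f 0 * partialTheta q x)
    (fun x => ?_) x ((hl x).sub ((tendsto_partialTheta_mul_pow hq x).const_mul _)))
  linear_combination h1 x - f 0 * partialTheta_add_mul hq x

end PartialTheta

/-! ### The sums `qSum` and the product formula. -/

/-- The term `(c q^n;q)_n q^{kn} (q^{n+1}, x q^n, y q^n;q)_∞`. -/
noncomputable def qTerm (q : ℂ) (k : ℕ) (c x y : ℂ) (n : ℕ) : ℂ :=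
  qPoch (c * q ^ n) q n * q ^ (k * n) *
    (qPochInf (q * q ^ n) q * qPochInf (x * q ^ n) q * qPochInf (y * q ^ n) q)

/-- The series `∑ (c q^n;q)_n q^{kn} (q^{n+1}, x q^n, y q^n;q)_∞`. -/
noncomputable def qSum (q : ℂ) (k : ℕ) (c x y : ℂ) : ℂ := ∑' n : ℕ, qTerm q k c x y n

section QSum

variable {q : ℂ}

lemma qTerm_comm (k : ℕ) (c x y : ℂ) (n : ℕ) : qTerm q k c x y n = qTerm q k c y x n := by
  unfold qTerm
  ring

lemma qSum_comm (k : ℕ) (c x y : ℂ) : qSum q k c x y = qSum q k c y x := by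
  simp only [qSum, qTerm_comm k c x y]

lemma norm_qTerm_le (hq : ‖q‖ < 1) {k : ℕ} {c x y : ℂ} {r s t : ℝ}
    (hc : ‖c‖ ≤ r) (hx : ‖x‖ ≤ s) (hy : ‖y‖ ≤ t) (n : ℕ) :
    ‖qTerm q k c x y n‖ ≤ Real.exp (r / (1 - ‖q‖)) * (‖q‖ ^ k) ^ n *
      (Real.exp (1 / (1 - ‖q‖)) * Real.exp (s / (1 - ‖q‖)) * Real.exp (t / (1 - ‖q‖))) := by
  unfold qTerm
  simp only [norm_mul, norm_pow, ← pow_mul]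
  gcongr
  · exact norm_qPoch_le hq ((norm_mul_pow_le c hq n).trans hc) n
  · exact norm_qPochInf_le hq ((norm_mul_pow_le q hq n).trans hq.le)
  · exact norm_qPochInf_le hq ((norm_mul_pow_le x hq n).trans hx)
  · exact norm_qPochInf_le hq ((norm_mul_pow_le y hq n).trans hy)

lemma summable_qTerm_bound (hq : ‖q‖ < 1) {k : ℕ} (hk : k ≠ 0) (A B : ℝ) :
    Summable fun n : ℕ => A * (‖q‖ ^ k) ^ n * B :=
  ((summable_geometric_of_lt_one (by positivity)
    (pow_lt_one₀ (norm_nonneg q) hq hk)).mul_left A).mul_right B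

lemma summable_qTerm (hq : ‖q‖ < 1) {k : ℕ} (hk : k ≠ 0) (c x y : ℂ) :
    Summable (qTerm q k c x y) :=
  (summable_qTerm_bound hq hk _ _).of_norm_bounded
    (norm_qTerm_le hq le_rfl le_rfl le_rfl)

lemma tendsto_qSum_mul_pow (hq : ‖q‖ < 1) {k : ℕ} (hk : k ≠ 0) (c x y : ℂ) :
    Tendsto (fun N : ℕ => qSum q k (x * q ^ N * c) (x * q ^ N) y) atTop
      (𝓝 (qSum q k (0 * c) 0 y)) := by
  refine tendsto_tsum_of_dominated_convergence
    (summable_qTerm_bound hq hk _ _) (fun n => ?_)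
    (Eventually.of_forall fun N =>
      norm_qTerm_le hq (r := ‖x‖ * ‖c‖) ?_ (norm_mul_pow_le x hq N) (le_refl ‖y‖))
  · have hx := tendsto_mul_pow_zero x hq
    have h1 : Tendsto (fun N : ℕ => qPoch (x * q ^ N * c * q ^ n) q n) atTop (𝓝 1) :=
      tendsto_one_of_norm_sub_one_le (q := q) (by simpa using (hx.mul_const c).mul_const (q ^ n))
        fun N => norm_qPoch_sub_one_le _ hq n
    have h2 : Tendsto (fun N : ℕ => qPochInf (x * q ^ N * q ^ n) q) atTop (𝓝 1) :=
      tendsto_one_of_norm_sub_one_le (q := q) (by simpa using hx.mul_const (q ^ n))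
        fun N => norm_qPochInf_sub_one_le _ hq
    have e : qTerm q k (0 * c) 0 y n = 1 * q ^ (k * n) *
        (qPochInf (q * q ^ n) q * 1 * qPochInf (y * q ^ n) q) := by
      simp [qTerm, qPoch, qPochInf]
    rw [e]
    exact (h1.mul_const _).mul ((h2.const_mul _).mul_const _)
  · rw [norm_mul]
    exact mul_le_mul_of_nonneg_right (norm_mul_pow_le x hq N) (norm_nonneg c)

/-- The sum telescopes, the terms being (q^{n+1};q)_∞ - (q^n;q)_∞. It fixes the constant in the
product formula. -/
lemma qSum_zero_zero (hq : ‖q‖ < 1) : qSum q 1 0 0 0 = 1 := by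
  have e : ∀ n : ℕ, qTerm q 1 0 0 0 n = qPochInf (q ^ (n + 1)) q - qPochInf (q ^ n) q := fun n => by
    rw [qPochInf_eq_mul (q ^ n) hq]
    simp [qTerm, qPoch, qPochInf, ← pow_succ, ← pow_succ']
    ring
  have h1 : Tendsto (fun n : ℕ => qPochInf (q ^ n) q) atTop (𝓝 1) :=
    tendsto_one_of_norm_sub_one_le (q := q) (tendsto_pow_atTop_nhds_zero_of_norm_lt_one hq)
      fun n => norm_qPochInf_sub_one_le _ hq
  have h0 : qPochInf (q ^ 0) q = 0 := by
    rw [qPochInf_eq_mul _ hq]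
    simp
  refine tendsto_nhds_unique (summable_qTerm hq one_ne_zero 0 0 0).hasSum.tendsto_sum_nat ?_
  simp only [e, Finset.sum_range_sub fun n => qPochInf (q ^ n) q, h0, sub_zero]
  exact h1

/-- Termwise form of the q-difference equation in x; the index shift on the right absorbs the factor
1 - q^{n+1}. -/
lemma qTerm_one_shift (hq0 : q ≠ 0) (hq : ‖q‖ < 1) (x y : ℂ) (n : ℕ) :
    qTerm q 1 (x * (y / q)) x y (n + 1) + (x - 1) * qTerm q 1 (x * q * (y / q)) (x * q) y (n + 1) =
      x * q * qTerm q 1 (x * q ^ 2 * (y / q)) (x * q ^ 2) y n := by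
  have e1 : x * (y / q) * q ^ (n + 1) = x * y * q ^ n := by field_simp; ring
  have e2 : x * q * (y / q) * q ^ (n + 1) = x * y * q ^ n * q := by field_simp; ring
  have e3 : x * q ^ 2 * (y / q) * q ^ n = x * y * q ^ n * q := by field_simp
  unfold qTerm
  rw [e1, e2, e3, qPoch_succ', qPoch_succ,
    qPochInf_eq_mul (q * q ^ n) hq, qPochInf_eq_mul (y * q ^ n) hq,
    qPochInf_eq_mul (x * q ^ (n + 1)) hq,
    show x * q ^ (n + 1) * q = x * q ^ 2 * q ^ n by ring,
    show x * q * q ^ (n + 1) = x * q ^ 2 * q ^ n by ring,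
    show q * q ^ (n + 1) = q * q ^ n * q by ring, show y * q ^ (n + 1) = y * q ^ n * q by ring]
  ring

/-- `∑ (xy q^{n-1};q)_n q^n (q^{n+1}, x q^n, y q^n;q)_∞ = θ(q,x) θ(q,y)`. -/
theorem qSum_eq_partialTheta_mul (hq0 : q ≠ 0) (hq : ‖q‖ < 1) (x y : ℂ) :
    qSum q 1 (x * (y / q)) x y = partialTheta q x * partialTheta q y := by
  have main : ∀ x y : ℂ,
      qSum q 1 (x * (y / q)) x y = qSum q 1 (0 * (y / q)) 0 y * partialTheta q x := fun x y => by
    refine eq_mul_partialTheta hq (f := fun x => qSum q 1 (x * (y / q)) x y) (fun x => ?_)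
      (fun x => tendsto_qSum_mul_pow hq one_ne_zero (y / q) x y) x
    have s := fun c x => summable_qTerm hq one_ne_zero c x y
    have h0 : qTerm q 1 (x * (y / q)) x y 0 +
        (x - 1) * qTerm q 1 (x * q * (y / q)) (x * q) y 0 = 0 := by
      simp only [qTerm, qPoch, pow_zero, mul_one, mul_zero, Finset.range_zero, Finset.prod_empty,
        qPochInf_eq_mul x hq]
      ring
    have h1 := tsum_congr (L := .unconditional ℕ) (qTerm_one_shift hq0 hq x y)
    rw [tsum_mul_left, Summable.tsum_add ((summable_nat_add_iff 1).2 (s _ _))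
      (((summable_nat_add_iff 1).2 (s _ _)).mul_left _), tsum_mul_left] at h1
    simp only [qSum]
    rw [(s (x * (y / q)) x).tsum_eq_zero_add]
    have h2 := (s (x * q * (y / q)) (x * q)).tsum_eq_zero_add
    linear_combination h0 + h1 + (x - 1) * h2
  -- By symmetry, the same argument in the other variable, with the first one set to 0.
  have h0 : qSum q 1 (0 * (y / q)) 0 y = partialTheta q y := by
    have h := main y 0
    simp only [zero_div, mul_zero, qSum_zero_zero hq, one_mul] at h
    rw [zero_mul, qSum_comm, h]
  rw [main, h0, mul_comm]

/-! ### Contiguous relations. -/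

lemma qSum_div_eq (hq0 : q ≠ 0) (hq : ‖q‖ < 1) {k : ℕ} (hk : k ≠ 0) (c x y : ℂ) :
    qSum q k c (x / q) y = qSum q k c x y - x / q * qSum q (k + 1) c x y := by
  have s := fun k hk => summable_qTerm hq (k := k) hk c x y
  simp only [qSum]
  rw [← tsum_mul_left, ← (s k hk).tsum_sub ((s (k + 1) k.succ_ne_zero).mul_left _)]
  refine tsum_congr fun n => ?_
  unfold qTerm
  rw [qPochInf_eq_mul (x / q * q ^ n) hq,
    show x / q * q ^ n * q = x * q ^ n by
      rw [mul_right_comm, div_mul_cancel₀ _ hq0]]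
  ring

/-- Termwise with the second sum shifted by one: with m = n + 1, (1 - cq^m)q^m + (1 - q^m) = 1 -
cq^{2m}, the last factor of (cq^{m+1};q)_m. -/
lemma qSum_two_add (hq : ‖q‖ < 1) (c x y : ℂ) :
    qSum q 2 c x y + q * qSum q 1 (c * q ^ 2) (x * q) (y * q) = qSum q 1 (c * q) x y := by
  have s1 := summable_qTerm hq one_ne_zero
  have s2 := summable_qTerm hq two_ne_zero c x y
  simp only [qSum]
  rw [s2.tsum_eq_zero_add, (s1 (c * q) x y).tsum_eq_zero_add, ← tsum_mul_left, add_assoc,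
    ← ((summable_nat_add_iff 1).2 s2).tsum_add ((s1 _ _ _).mul_left _)]
  refine congrArg₂ (· + ·) (by simp [qTerm, qPoch]) ?_
  refine tsum_congr fun n => ?_
  unfold qTerm
  rw [show c * q * q ^ (n + 1) = c * q ^ (n + 1) * q by ring,
    show c * q ^ 2 * q ^ n = c * q ^ (n + 1) * q by ring, qPoch_succ', qPoch_succ,
    qPochInf_eq_mul (q * q ^ n) hq, show q * q ^ (n + 1) = q * q ^ n * q by ring,
    show x * q * q ^ n = x * q ^ (n + 1) by ring, show y * q * q ^ n = y * q ^ (n + 1) by ring]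
  ring

/-- `(x - y) ∑ (xy q^{n-2};q)_n q^n (q^{n+1}, x q^n, y q^n;q)_∞ = x θ(q,x) - y θ(q,y)`. -/
theorem sub_mul_qSum (hq0 : q ≠ 0) (hq : ‖q‖ < 1) (x y : ℂ) :
    (x - y) * qSum q 1 (x * y / q ^ 2) x y = x * partialTheta q x - y * partialTheta q y := by
  have key : ∀ x y : ℂ, qSum q 1 (x * y / q ^ 2) x y + x * qSum q 1 (x * y) (x * q) (y * q) =
      partialTheta q y := fun x y => by
    have h1 := qSum_div_eq hq0 hq one_ne_zero (x * y / q ^ 2) x y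
    have h2 := qSum_two_add hq (x * y / q ^ 2) x y
    have h3 := qSum_eq_partialTheta_mul hq0 hq (x / q) y
    have h4 := qSum_eq_partialTheta_mul hq0 hq x y
    have h5 := partialTheta_add_mul hq (x / q)
    rw [show x / q * (y / q) = x * y / q ^ 2 by field_simp] at h3
    rw [show x * y / q ^ 2 * q ^ 2 = x * y by field_simp,
      show x * y / q ^ 2 * q = x * (y / q) by field_simp] at h2
    rw [div_mul_cancel₀ x hq0] at h5
    have hx : x = x / q * q := by field_simp
    linear_combination h3 - h1 + (x / q) * (h4 + h2) + partialTheta q y * h5 +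
      qSum q 1 (x * y) (x * q) (y * q) * hx
  -- Exchanging x and y keeps both sums of `key`, so the one with xq, yq can be eliminated.
  have h := key y x
  rw [mul_comm y x, qSum_comm, qSum_comm _ _ (y * q)] at h
  linear_combination x * h - y * key x y

lemma sub_mul_qSum_succ (hq0 : q ≠ 0) (hq : ‖q‖ < 1) {k : ℕ} (hk : k ≠ 0) (c x y : ℂ) :
    (x - y) / q * qSum q (k + 1) c x y = qSum q k c x (y / q) - qSum q k c (x / q) y := by
  rw [qSum_comm _ _ x (y / q), qSum_div_eq hq0 hq hk c y x, qSum_div_eq hq0 hq hk c x y,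
    qSum_comm _ _ y x, qSum_comm _ _ y x]
  ring

lemma qTerm_two_eq (hq : ‖q‖ < 1) {a b : ℂ} (ha : ∀ n : ℕ, a * q ^ n ≠ 1)
    (hb : ∀ n : ℕ, b * q ^ n ≠ 1) (habq : ∀ n : ℕ, a * b / q ^ 3 * q ^ n ≠ 1) (n : ℕ) :
    qPochInf q q * qPochInf a q * qPochInf b q * seriesSTerm q a b n =
      qTerm q 2 (a * b / q ^ 3) a b n := by
  have hne : ∀ {x : ℂ}, (∀ n : ℕ, x * q ^ n ≠ 1) → qPoch x q n ≠ 0 := fun h =>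
    Finset.prod_ne_zero_iff.2 fun i _ => sub_ne_zero.2 (h i).symm
  have hqq : ∀ n : ℕ, q * q ^ n ≠ 1 := mul_pow_ne_one hq
  have h1 := hne ha
  have h2 := hne hb
  have h3 := hne habq
  have h4 := hne hqq
  rw [seriesSTerm, qTerm, two_mul n, qPoch_add, ← qPoch_mul_qPochInf q hq n,
    ← qPoch_mul_qPochInf a hq n, ← qPoch_mul_qPochInf b hq n]
  field_simp

end QSum

theorem mainTheorem9 (q a b : ℂ) (hq0 : q ≠ 0) (hq1 : ‖q‖ < 1)
    (ha0 : a ≠ 0) (hb0 : b ≠ 0) (hab : a ≠ b * q) (hba : b ≠ a * q)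
    (ha : ∀ n : ℕ, a * q ^ n ≠ 1) (hb : ∀ n : ℕ, b * q ^ n ≠ 1)
    (habq : ∀ n : ℕ, a * b / q ^ 3 * q ^ n ≠ 1) :
    Summable (seriesSTerm q a b) ∧
    (a ^ 2 + 2 * a * q + a * q ^ 2 - b * q ^ 2 + a * b) /
          (b * (a - b * q) * (b - a * q)) * partialTheta q a
      - (a + q) * (a + b) / (a * (a - b * q) * (b - a * q)) * partialTheta q b
      + (1 + q) * (b + q ^ 2) / (b * (a - b * q) * (b - a * q)) * partialTheta q (a / q)
      - (a * (1 + q) * (b + q ^ 2) + q * (a ^ 2 - b ^ 2)) /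
          (a * b * (a - b * q) * (b - a * q)) * partialTheta q (b / q)
    = -((a - b) / (q * a * b)) * seriesS q a b := by
  have hC : qPochInf q q * qPochInf a q * qPochInf b q ≠ 0 :=
    mul_ne_zero (mul_ne_zero (qPochInf_ne_zero hq1 (mul_pow_ne_one hq1))
      (qPochInf_ne_zero hq1 ha)) (qPochInf_ne_zero hq1 hb)
  have hterm := qTerm_two_eq hq1 ha hb habq
  have hS : seriesS q a b = qSum q 2 (a * b / q ^ 3) a b := by
    rw [seriesS, ← tsum_mul_left]
    exact tsum_congr hterm
  refine ⟨(summable_mul_left_iff hC).1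
    ((summable_qTerm hq1 two_ne_zero (a * b / q ^ 3) a b).congr fun n => (hterm n).symm), ?_⟩
  have h1 := sub_mul_qSum_succ hq0 hq1 one_ne_zero (a * b / q ^ 3) a b
  have h2 := sub_mul_qSum hq0 hq1 a (b / q)
  have h3 := sub_mul_qSum hq0 hq1 (a / q) b
  rw [show a * (b / q) / q ^ 2 = a * b / q ^ 3 by field_simp] at h2
  rw [show a / q * b / q ^ 2 = a * b / q ^ 3 by field_simp] at h3
  have h4 := partialTheta_add_mul hq1 (a / q)
  have h5 := partialTheta_add_mul hq1 (b / q)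
  rw [div_mul_cancel₀ _ hq0] at h4 h5
  have hd1 : a - b * q ≠ 0 := sub_ne_zero.2 hab
  have hd2 : b - a * q ≠ 0 := sub_ne_zero.2 hba
  rw [show -((a - b) / (q * a * b)) * seriesS q a b =
    -(1 / (a * b)) * ((a - b) / q * qSum q (1 + 1) (a * b / q ^ 3) a b) by rw [hS]; field_simp, h1]
  have hd4 : a - q * b ≠ 0 := by rwa [mul_comm q b]
  have hd3 : a * q - b ≠ 0 := fun h => hd2 (by linear_combination -h)
  have e2 : qSum q 1 (a * b / q ^ 3) a (b / q) =
      (a * q * partialTheta q a - b * partialTheta q (b / q)) / (a * q - b) := by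
    rw [eq_div_iff hd3]
    field_simp at h2
    linear_combination h2
  have e3 : qSum q 1 (a * b / q ^ 3) (a / q) b =
      (a * partialTheta q (a / q) - b * q * partialTheta q b) / (a - b * q) := by
    rw [eq_div_iff hd1]
    field_simp at h3
    linear_combination h3
  -- Only θ(q,a) and θ(q,b) remain, and the claim becomes a rational identity.
  have e4 : partialTheta q (a / q) = 1 - a / q * partialTheta q a := by linear_combination h4
  have e5 : partialTheta q (b / q) = 1 - b / q * partialTheta q b := by linear_combination h5
  have hd5 : b - q * a ≠ 0 := by rwa [mul_comm q a]
  rw [e2, e3, e4, e5, ← neg_sub b (a * q)]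
  field_simp
  ring
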